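/- Let $q$ be a prime power, let $\mathbb F_q$ be the finite field with $q$ elements and let $n\ge 0$ be an integer. For a map $T:\mathbb F_q^n\to\mathbb F_q^n$, its functional graph is the directed graph with vertex set $\mathbb F_q^n$ and edges $v\to T(v)$ for $v\in\mathbb F_q^n$. Let $B_q(n)$ be the number of isomorphism classes of functional graphs of bijective $\mathbb F_q$-linear maps $T:\mathbb F_q^n\to\mathbb F_q^n$, and for $i\ge 1$ let $\sigma_i$ be the number of positive divisors of $q^i-1$. Then $$B_q(n)\le \sum_{\lambda\vdash n}\ \prod_{i=1}^n\binom{\sigma_i+\lambda_i-1}{\lambda_i},$$ where the sum is over all partitions $\lambda$ of $n$, written as vectors $\lambda=(\lambda_1,\dots,\lambda_n)$ of nonnegative integers with $\sum_{i=1}^n i\,\lambda_i=n$ (so $\lambda_i$ is the number of parts equal to $i$). -/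

import Mathlib

/-- Two directed graphs are isomorphic if some bijection of their vertex sets preserves and
reflects adjacency. -/
def digraphIso {V W : Type*} (G : Digraph V) (H : Digraph W) : Prop :=
  Nonempty (G.Adj ≃r H.Adj)

/-- Isomorphism, as an equivalence relation on the directed graphs with vertex set `V`. -/
def digraphIsoSetoid (V : Type*) : Setoid (Digraph V) where
  r G H := digraphIso G H
  iseqv :=
    { refl := fun G => ⟨RelIso.refl G.Adj⟩
      symm := fun ⟨e⟩ => ⟨e.symm⟩
      trans := fun ⟨e⟩ ⟨f⟩ => ⟨e.trans f⟩ }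

/-- The functional graph of a self-map `T` of `V`: its edges are `v → T v`, for `v` in `V`. -/
def functionalGraph {V : Type*} (T : V → V) : Digraph V where
  Adj v w := T v = w

/-- The set of isomorphism classes of the functional graphs of the bijective `F`-linear maps
from `F^n` to itself. -/
def bijLinearGraphClasses (F : Type*) [Field F] (n : ℕ) :
    Set (Quotient (digraphIsoSetoid (Fin n → F))) :=
  {c | ∃ T : (Fin n → F) →ₗ[F] (Fin n → F), Function.Bijective T ∧
    c = Quotient.mk (digraphIsoSetoid (Fin n → F)) (functionalGraph T)}

/-- The number of non-isomorphic functional graphs of bijective `F`-linear maps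
from `F^n` to itself. -/
noncomputable def numBijLinearGraphs (F : Type*) [Field F] (n : ℕ) : ℕ :=
  (bijLinearGraphClasses F n).ncard

/-- The number of positive divisors of `q ^ i - 1`. -/
def numDivisors (q i : ℕ) : ℕ := (q ^ i - 1).divisors.card

/-! A bijection of a finite set is determined up to conjugacy by the numbers of fixed points of its
powers, and conjugate bijections have isomorphic functional graphs. Let `X` act on `F^n` as `T`; the
module is a direct sum of blocks `F[X] / (p ^ k)`, and the fixed points of `T^j` form the kernel of
`X ^ j - 1`. As `T` has finite order, each `p` of a nonzero block divides a cyclotomic polynomial of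
order `e` prime to the characteristic. Then `deg p` is the order of `q` modulo `e`, and the
multiplicity of `p` in `X ^ j - 1` depends only on `e` and `j`. So the dimension `d = k * deg p` and
the divisor `e` of `q ^ d - 1` determine the fixed-point counts of a block. A class is thus encoded
injectively by a partition of `n` with such labels on its parts, and the right-hand side counts
these. -/

/-! ### Cycle types and fixed points of powers -/

/-- A multiset of positive numbers is determined by the sums of its elements dividing `j`,
for all `j > 0`. -/
theorem Multiset.eq_of_sum_filter_dvd_eq {s t : Multiset ℕ} (hs : ∀ i ∈ s, 0 < i)
    (ht : ∀ i ∈ t, 0 < i)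
    (h : ∀ j, 0 < j → (s.filter (· ∣ j)).sum = (t.filter (· ∣ j)).sum) : s = t := by
  have key : ∀ (u : Multiset ℕ) (j : ℕ), 0 < j →
      (u.filter (· ∣ j)).sum = j * u.count j + ∑ e ∈ j.properDivisors, e * u.count e := by
    intro u j hj
    have h1 : ∑ e ∈ j.divisors, e * u.count e = (u.filter (· ∣ j)).sum := by
      rw [Finset.sum_multiset_count_of_subset (u.filter (· ∣ j)) j.divisors]
      · refine Finset.sum_congr rfl fun e he => ?_
        rw [Multiset.count_filter_of_pos (p := (· ∣ j)) (Nat.dvd_of_mem_divisors he), smul_eq_mul,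
          mul_comm]
      · intro e he
        simp only [Multiset.mem_toFinset, Multiset.mem_filter] at he
        exact Nat.mem_divisors.2 ⟨he.2, hj.ne'⟩
    rw [← h1, ← Nat.insert_self_properDivisors hj.ne',
      Finset.sum_insert Nat.self_notMem_properDivisors]
  ext j
  induction j using Nat.strong_induction_on with
  | _ j ih =>
    rcases Nat.eq_zero_or_pos j with rfl | hj
    · rw [Multiset.count_eq_zero_of_notMem fun h0 => (hs 0 h0).false,
        Multiset.count_eq_zero_of_notMem fun h0 => (ht 0 h0).false]
    · have := h j hj
      rw [key s j hj, key t j hj, Finset.sum_congr rfl fun e he => by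
        rw [ih e (Nat.mem_properDivisors.1 he).2]] at this
      exact Nat.eq_of_mul_eq_mul_left hj (Nat.add_right_cancel this)

/-- The points of `σ.support` fixed by `σ ^ j` are counted by the cycles of length dividing `j`. -/
theorem Equiv.Perm.card_filter_support_pow_apply_eq {α : Type*} [Fintype α] [DecidableEq α]
    (σ : Equiv.Perm α) (j : ℕ) :
    (σ.support.filter fun x => (σ ^ j) x = x).card = (σ.cycleType.filter (· ∣ j)).sum := by
  have h : (σ.support.filter fun x => (σ ^ j) x = x) =
      (σ.cycleFactorsFinset.filter fun c => c.support.card ∣ j).biUnion fun c => c.support := by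
    ext x
    simp only [Finset.mem_filter, Finset.mem_biUnion]
    have hfix : ∀ c ∈ σ.cycleFactorsFinset, x ∈ c.support →
        ((σ ^ j) x = x ↔ c.support.card ∣ j) := by
      intro c hc hx
      obtain rfl := Equiv.Perm.cycle_is_cycleOf hx hc
      have hcyc := (Equiv.Perm.mem_cycleFactorsFinset_iff.1 hc).1
      rw [← hcyc.orderOf, orderOf_dvd_iff_pow_eq_one,
        hcyc.pow_eq_one_iff' (Equiv.Perm.mem_support.1 hx), Equiv.Perm.cycleOf_pow_apply_self]
    constructor
    · rintro ⟨hx, hj⟩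
      have hc := Equiv.Perm.cycleOf_mem_cycleFactorsFinset_iff.2 hx
      have hxc : x ∈ (σ.cycleOf x).support :=
        Equiv.Perm.mem_support_cycleOf_iff.2 ⟨Equiv.Perm.SameCycle.refl _ _, hx⟩
      exact ⟨σ.cycleOf x, ⟨hc, (hfix _ hc hxc).1 hj⟩, hxc⟩
    · rintro ⟨c, ⟨hc, hj⟩, hx⟩
      exact ⟨Equiv.Perm.mem_cycleFactorsFinset_support_le hc hx, (hfix c hc hx).2 hj⟩
  rw [h, Finset.card_biUnion, Equiv.Perm.cycleType_def, Multiset.filter_map]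
  · rfl
  · intro c hc d hd hcd
    exact (σ.cycleFactorsFinset_pairwise_disjoint (Finset.mem_filter.1 hc).1
      (Finset.mem_filter.1 hd).1 hcd).disjoint_support

theorem Equiv.Perm.card_filter_pow_apply_eq {α : Type*} [Fintype α] [DecidableEq α]
    (σ : Equiv.Perm α) (j : ℕ) :
    (Finset.univ.filter fun x => (σ ^ j) x = x).card =
      (σ.partition.parts.filter (· ∣ j)).sum := by
  rw [Equiv.Perm.parts_partition, Multiset.filter_add, Multiset.sum_add,
    ← σ.card_filter_support_pow_apply_eq, 
    -- The parts equal to 1 are the fixed points of `σ`, and they survive every filter.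
    (Multiset.filter_eq_self (s := .replicate _ _)).2 fun a ha => by
      rw [Multiset.eq_of_mem_replicate ha]; exact one_dvd j,
    Multiset.sum_replicate, smul_eq_mul, mul_one, ← Finset.card_compl, ← Finset.card_union_of_disjoint]
  · congr 1
    ext x
    by_cases hx : σ x = x
    · simp [hx, Equiv.Perm.pow_apply_eq_self_of_apply_eq_self hx]
    · simp [hx]
  · exact (disjoint_compl_right (a := σ.support)).mono_left (Finset.filter_subset _ _)

/-- Permutations whose powers have the same numbers of fixed points are conjugate. -/
theorem Equiv.Perm.isConj_of_card_fixed_pow_eq {α : Type*} [Finite α] {σ τ : Equiv.Perm α}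
    (h : ∀ j, 0 < j → Nat.card {x // (σ ^ j) x = x} = Nat.card {x // (τ ^ j) x = x}) :
    IsConj σ τ := by
  classical
  have := Fintype.ofFinite α
  rw [Equiv.Perm.partition_eq_of_isConj, Nat.Partition.ext_iff]
  refine Multiset.eq_of_sum_filter_dvd_eq (fun _ => σ.partition.parts_pos)
    (fun _ => τ.partition.parts_pos) fun j hj => ?_
  simpa only [← card_filter_pow_apply_eq, Nat.card_eq_fintype_card, Fintype.card_subtype]
    using h j hj

theorem digraphIso_functionalGraph_of_card_fixed_eq {α : Type*} [Finite α] {f g : α → α}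
    (hf : Function.Bijective f) (hg : Function.Bijective g)
    (h : ∀ j, 0 < j → Nat.card {x // f^[j] x = x} = Nat.card {x // g^[j] x = x}) :
    digraphIso (functionalGraph f) (functionalGraph g) := by
  have hc : IsConj (Equiv.ofBijective f hf) (Equiv.ofBijective g hg) := by
    refine Equiv.Perm.isConj_of_card_fixed_pow_eq fun j hj => ?_
    simpa only [Equiv.Perm.coe_pow, Equiv.ofBijective_apply, Equiv.coe_ofBijective] using! h j hj
  obtain ⟨c, hc⟩ := isConj_iff.1 hc
  refine ⟨⟨c, ?_⟩⟩
  intro a b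
  have := Equiv.ext_iff.1 (mul_inv_eq_iff_eq_mul.1 hc) a
  simp only [Equiv.Perm.mul_apply, Equiv.ofBijective_apply] at this
  simp only [functionalGraph]
  rw [← this, c.injective.eq_iff]

/-! ### Kernels on primary cyclic modules -/

/-- In a principal ideal domain, the elements of `R / (p ^ k)` killed by an element in which the
prime `p` has multiplicity `c` are counted by `R / (p ^ min k c)`. -/
theorem Irreducible.card_smul_eq_zero_quotient_pow {R : Type*} [CommRing R] [IsDomain R]
    [IsPrincipalIdealRing R] {p v : R} (hp : Irreducible p) (hv : ¬ p ∣ v) (k c : ℕ) :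
    Nat.card {x : R ⧸ Ideal.span {p ^ k} // (p ^ c * v) • x = 0} =
      Nat.card (R ⧸ Ideal.span {p ^ min k c}) := by
  have hmk : ∀ f : R, (Ideal.span {p ^ k}).mkQ f = 0 ↔ p ^ k ∣ f := fun f => by
    rw [Submodule.mkQ_apply, Submodule.Quotient.mk_eq_zero, Ideal.mem_span_singleton]
  -- The killed elements are the multiples of `p ^ (k - c)`; if `c ≥ k`, truncated subtraction makes
  -- `θ` the quotient map, and everything is killed.
  let θ : R →ₗ[R] R ⧸ Ideal.span {p ^ k} :=
    (Ideal.span {p ^ k}).mkQ ∘ₗ LinearMap.mulLeft R (p ^ (k - c))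
  have hker : LinearMap.ker θ = Ideal.span {p ^ min k c} := by
    ext f
    rw [LinearMap.mem_ker, Ideal.mem_span_singleton, LinearMap.comp_apply,
      LinearMap.mulLeft_apply, hmk]
    conv_lhs => rw [show p ^ k = p ^ (k - c) * p ^ min k c by
      rw [← pow_add, Nat.sub_add_min_cancel]]
    exact mul_dvd_mul_iff_left (pow_ne_zero _ hp.ne_zero)
  have hrange : ∀ x, x ∈ LinearMap.range θ ↔ (p ^ c * v) • x = 0 := by
    intro x
    obtain ⟨f, rfl⟩ := Submodule.mkQ_surjective _ x
    rw [← map_smul, hmk, smul_eq_mul]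
    have hcop : IsCoprime (p ^ k) v := ((hp.coprime_iff_not_dvd).2 hv).pow_left
    have h1 : p ^ k ∣ p ^ c * v * f ↔ p ^ (k - c) ∣ f := by
      rw [mul_right_comm, (⟨hcop.dvd_of_dvd_mul_right, fun h => h.mul_right v⟩ :
        p ^ k ∣ p ^ c * f * v ↔ p ^ k ∣ p ^ c * f)]
      rcases le_total c k with h | h
      · conv_lhs => rw [← Nat.add_sub_cancel' h, pow_add]
        exact mul_dvd_mul_iff_left (pow_ne_zero _ hp.ne_zero)
      · rw [Nat.sub_eq_zero_of_le h, pow_zero]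
        exact iff_of_true ((pow_dvd_pow p h).mul_right f) (one_dvd f)
    rw [h1]
    constructor
    · rintro ⟨g, hg⟩
      rw [LinearMap.comp_apply, LinearMap.mulLeft_apply, ← sub_eq_zero, ← map_sub, hmk] at hg
      exact (dvd_sub_right (dvd_mul_right _ _)).1 ((pow_dvd_pow p (Nat.sub_le k c)).trans hg)
    · rintro ⟨g, rfl⟩
      exact ⟨g, rfl⟩
  rw [← Nat.card_congr (Equiv.subtypeEquivRight hrange),
    ← Nat.card_congr θ.quotKerEquivRange.toEquiv, hker]

/-! ### Irreducible factors of `X ^ j - 1` over a finite field -/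

namespace Polynomial

variable {F : Type*} [Field F]

theorem card_quotient_span [Fintype F] {P : F[X]} (hP : P ≠ 0) :
    Nat.card (F[X] ⧸ Ideal.span {P}) = Fintype.card F ^ P.natDegree := by
  have : Module.Finite F (F[X] ⧸ Ideal.span {P}) :=
    (AdjoinRoot.powerBasis hP).finite
  rw [Module.natCard_eq_pow_finrank (K := F), finrank_quotient_span_eq_natDegree,
    Nat.card_eq_fintype_card]

theorem X_pow_sub_one_eq_pow_ordProj (c : ℕ) [Fact c.Prime] [CharP F c] (j : ℕ) :
    (X ^ j - 1 : F[X]) = (X ^ (j / c ^ j.factorization c) - 1) ^ c ^ j.factorization c := by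
  rw [sub_pow_char_pow, one_pow, ← pow_mul, mul_comm, Nat.ordProj_mul_ordCompl_eq_self]

/-- An irreducible divisor of `X ^ J - 1` divides a cyclotomic polynomial of order prime to the
characteristic. -/
theorem exists_dvd_cyclotomic (c : ℕ) [hc : Fact c.Prime] [CharP F c] {p : F[X]}
    (hp : Irreducible p) {J : ℕ} (hJ : 0 < J) (h : p ∣ X ^ J - 1) :
    ∃ e, c.Coprime e ∧ p ∣ cyclotomic e F := by
  rw [X_pow_sub_one_eq_pow_ordProj c] at h
  have h := hp.prime.dvd_of_dvd_pow h
  rw [← prod_cyclotomic_eq_X_pow_sub_one (Nat.ordCompl_pos c hJ.ne') F,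
    hp.prime.dvd_finsetProd_iff] at h
  obtain ⟨e, he, h⟩ := h
  exact ⟨e, (Nat.coprime_ordCompl hc.out hJ.ne').coprime_dvd_right (Nat.dvd_of_mem_divisors he), h⟩

/-- As `e` is invertible in `F`, the root of `p` in `AdjoinRoot p` is a primitive `e`-th root of
unity. -/
theorem dvd_X_pow_sub_one_iff_of_dvd_cyclotomic (c : ℕ) [hc : Fact c.Prime] [CharP F c] {p : F[X]}
    (hp : Irreducible p) {e : ℕ} (hce : c.Coprime e) (h : p ∣ cyclotomic e F) (j : ℕ) :
    p ∣ X ^ j - 1 ↔ e ∣ j := by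
  have : Fact (Irreducible p) := ⟨hp⟩
  have : NeZero (e : AdjoinRoot p) := by
    have : NeZero (e : F) := ⟨fun h0 => (hc.out.coprime_iff_not_dvd.1 hce)
      ((CharP.cast_eq_zero_iff F c e).1 h0)⟩
    simpa using! NeZero.of_injective (algebraMap F (AdjoinRoot p)).injective
  have hζ : IsPrimitiveRoot (AdjoinRoot.root p) e := by
    rw [← isRoot_cyclotomic_iff, ← map_cyclotomic e (AdjoinRoot.of p)]
    exact (AdjoinRoot.isRoot_root p).dvd (Polynomial.map_dvd _ h)
  rw [← hζ.pow_eq_one_iff_dvd, ← AdjoinRoot.mk_eq_zero, map_sub, map_pow, AdjoinRoot.mk_X, map_one,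
    sub_eq_zero]

/-- The multiplicity in `X ^ j - 1` of an irreducible factor of the `e`-th cyclotomic polynomial
over a field of characteristic `c`. -/
def cyclotomicMultiplicity (c e j : ℕ) : ℕ := if e ∣ j then c ^ j.factorization c else 0

theorem exists_X_pow_sub_one_eq_pow_mul (c : ℕ) [hc : Fact c.Prime] [CharP F c] {p : F[X]}
    (hp : Irreducible p) {e : ℕ} (hce : c.Coprime e) (h : p ∣ cyclotomic e F) {j : ℕ}
    (hj : 0 < j) :
    ∃ v, ¬ p ∣ v ∧ (X ^ j - 1 : F[X]) = p ^ cyclotomicMultiplicity c e j * v := by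
  have hdvd := dvd_X_pow_sub_one_iff_of_dvd_cyclotomic c hp hce h
  rw [cyclotomicMultiplicity]
  split_ifs with hej
  · have h1 := (hdvd j).2 hej
    rw [X_pow_sub_one_eq_pow_ordProj c] at h1 ⊢
    obtain ⟨v, hv⟩ := hp.prime.dvd_of_dvd_pow h1
    refine ⟨v ^ c ^ j.factorization c, fun hpv => ?_, by rw [hv, mul_pow]⟩
    -- The exponent left after removing the powers of `c` is prime to `c`, so this polynomial is
    -- separable and `p` occurs in it exactly once.
    have hsq : Squarefree (X ^ (j / c ^ j.factorization c) - 1 : F[X]) :=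
      (X_pow_sub_one_separable_iff.2 fun h0 =>
        Nat.not_dvd_ordCompl hc.out hj.ne' ((CharP.cast_eq_zero_iff F c _).1 h0)).squarefree
    exact hp.not_isUnit (hsq p (hv ▸ mul_dvd_mul_left p (hp.prime.dvd_of_dvd_pow hpv)))
  · exact ⟨X ^ j - 1, fun h1 => hej ((hdvd j).1 h1), by rw [pow_zero, one_mul]⟩

variable [Fintype F]

theorem natDegree_eq_orderOf_of_dvd_cyclotomic (c : ℕ) [hc : Fact c.Prime] [CharP F c] {p : F[X]}
    (hp : Irreducible p) {e : ℕ} (hce : c.Coprime e) (h : p ∣ cyclotomic e F) :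
    p.natDegree = orderOf (Fintype.card F : ZMod e) := by
  obtain ⟨f, -, hf⟩ := FiniteField.card F c
  rw [natDegree_of_dvd_cyclotomic_of_irreducible hf hce h hp, ← orderOf_units,
    ZMod.coe_unitOfCoprime, hf]

theorem dvd_card_pow_natDegree_mul_sub_one (c : ℕ) [hc : Fact c.Prime] [CharP F c] {p : F[X]}
    (hp : Irreducible p) {e : ℕ} (hce : c.Coprime e) (h : p ∣ cyclotomic e F) (k : ℕ) :
    e ∣ Fintype.card F ^ (p.natDegree * k) - 1 := by
  rw [← ZMod.natCast_eq_zero_iff, Nat.cast_sub (Nat.one_le_pow _ _ Fintype.card_pos), Nat.cast_pow,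
    natDegree_eq_orderOf_of_dvd_cyclotomic c hp hce h, pow_mul, pow_orderOf_eq_one, one_pow,
    Nat.cast_one, sub_self]

/-- The exponent of `q` in the number of fixed points of the `j`-th power of multiplication
by `X` on `F[X] / (p ^ k)`, where `F` has `q` elements and characteristic `c`, `p` is an
irreducible factor of the `e`-th cyclotomic polynomial, and `d` is the dimension. -/
noncomputable def fixedExponent (q c j d e : ℕ) : ℕ :=
  orderOf (q : ZMod e) * min (d / orderOf (q : ZMod e)) (cyclotomicMultiplicity c e j)

theorem fixedExponent_zero (q c j e : ℕ) : fixedExponent q c j 0 e = 0 := by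
  simp [fixedExponent]

theorem card_X_pow_sub_one_smul_eq_zero (c : ℕ) [hc : Fact c.Prime] [CharP F c] {p : F[X]}
    (hp : Irreducible p) {e : ℕ} (hce : c.Coprime e) (h : p ∣ cyclotomic e F) {j : ℕ}
    (hj : 0 < j) (k : ℕ) :
    Nat.card {x : F[X] ⧸ Ideal.span {p ^ k} // (X ^ j - 1 : F[X]) • x = 0} =
      Fintype.card F ^ fixedExponent (Fintype.card F) c j (p.natDegree * k) e := by
  obtain ⟨v, hv, hX⟩ := exists_X_pow_sub_one_eq_pow_mul c hp hce h hj
  rw [hX, hp.card_smul_eq_zero_quotient_pow hv, card_quotient_span (pow_ne_zero _ hp.ne_zero),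
    natDegree_pow, fixedExponent, ← natDegree_eq_orderOf_of_dvd_cyclotomic c hp hce h,
    Nat.mul_div_cancel_left _ hp.natDegree_pos, mul_comm]

end Polynomial

namespace Polynomial

variable {F : Type*} [Field F] [Fintype F]

/-- The dimension and the order attached to a primary cyclic module on which `X` acts with finite
order determine the numbers of fixed points of the powers of `X`. -/
theorem exists_card_smul_eq_zero_eq_pow_fixedExponent (c : ℕ) [hc : Fact c.Prime] [CharP F c]
    {p : F[X]} (hp : Irreducible p) (k : ℕ) {J : ℕ} (hJ : 0 < J)
    (h : ∀ x : F[X] ⧸ Ideal.span {p ^ k}, (X ^ J - 1 : F[X]) • x = 0) :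
    ∃ e, e ∣ Fintype.card F ^ (p.natDegree * k) - 1 ∧ ∀ j, 0 < j →
      Nat.card {x : F[X] ⧸ Ideal.span {p ^ k} // (X ^ j - 1 : F[X]) • x = 0} =
        Fintype.card F ^ fixedExponent (Fintype.card F) c j (p.natDegree * k) e := by
  rcases Nat.eq_zero_or_pos k with rfl | hk
  -- A zero block says nothing about `p`; any label would do, since `q ^ 0 - 1 = 0`.
  · refine ⟨1, one_dvd _, fun j _ => ?_⟩
    have : Subsingleton (F[X] ⧸ Ideal.span {p ^ 0}) := by
      rw [Ideal.Quotient.subsingleton_iff, pow_zero, Ideal.span_singleton_one]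
    rw [mul_zero, fixedExponent_zero]
    refine Nat.card_eq_one_iff_unique.2 ?_
    exact ⟨inferInstance, ⟨⟨0, smul_zero _⟩⟩⟩
  · have h1 := h (Submodule.Quotient.mk 1)
    rw [← Submodule.Quotient.mk_smul, Submodule.Quotient.mk_eq_zero, Ideal.mem_span_singleton,
      smul_eq_mul, mul_one] at h1
    obtain ⟨e, hce, he⟩ := exists_dvd_cyclotomic c hp hJ ((dvd_pow_self p hk.ne').trans h1)
    exact ⟨e, dvd_card_pow_natDegree_mul_sub_one c hp hce he k, fun j hj =>
      card_X_pow_sub_one_smul_eq_zero c hp hce he hj k⟩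

end Polynomial

open Polynomial in
/-- The numbers of fixed points of the powers of a bijective linear map over a finite field are
determined by the dimensions and orders attached to its primary cyclic summands. -/
theorem LinearMap.exists_card_iterate_eq_pow_sum_fixedExponent.{u} {F : Type u} [Field F] [Fintype F]
    (c : ℕ) [hc : Fact c.Prime] [CharP F c] {V : Type*} [AddCommGroup V] [Module F V]
    [Module.Finite F V] (T : V →ₗ[F] V) (hT : Function.Bijective T) :
    ∃ (ι : Type u) (_ : Fintype ι) (d e : ι → ℕ), ∑ i, d i = Module.finrank F V ∧
      (∀ i, e i ∣ Fintype.card F ^ d i - 1) ∧ ∀ j, 0 < j →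
        Nat.card {x // T^[j] x = x} =
          Fintype.card F ^ ∑ i, fixedExponent (Fintype.card F) c j (d i) (e i) := by
  classical
  have : Finite V := Module.finite_of_finite F
  obtain ⟨ι, _, p, hp, k, ⟨E₀⟩⟩ := Module.equiv_directSum_of_isTorsion
    (Module.AEval.isTorsion_of_finiteDimensional F V T)
  let E := E₀.trans (DirectSum.linearEquivFunOnFintype F[X] ι _)
  have hsmul : ∀ (j : ℕ) (x : V),
      (X ^ j - 1 : F[X]) • Module.AEval'.of T x = 0 ↔ T^[j] x = x := by
    intro j x
    rw [sub_smul, one_smul, Module.AEval'.X_pow_smul_of, sub_eq_zero,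
      (Module.AEval'.of T).injective.eq_iff, Module.End.smul_def, Module.End.pow_apply]
  obtain ⟨J, hJ, hTJ⟩ : ∃ J, 0 < J ∧ ∀ x, T^[J] x = x := by
    refine ⟨orderOf (Equiv.ofBijective T hT), orderOf_pos _, fun x => ?_⟩
    have := Equiv.ext_iff.1 (pow_orderOf_eq_one (Equiv.ofBijective T hT)) x
    rwa [Equiv.Perm.coe_pow] at this
  -- This is where bijectivity enters: the finite order of `T` passes to every block and excludes `p
  -- = X` from the nonzero ones.
  have hkill : ∀ i (x : F[X] ⧸ Ideal.span {p i ^ k i}), (X ^ J - 1 : F[X]) • x = 0 := by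
    intro i x
    have h1 : (X ^ J - 1 : F[X]) • E.symm (Pi.single i x) = 0 := by
      obtain ⟨y, hy⟩ := (Module.AEval'.of T).surjective (E.symm (Pi.single i x))
      rw [← hy, hsmul, hTJ]
    rw [← map_smul, LinearEquiv.map_eq_zero_iff] at h1
    have h2 := congr_fun h1 i
    rwa [Pi.smul_apply, Pi.single_eq_same] at h2
  have hblock := fun i =>
    exists_card_smul_eq_zero_eq_pow_fixedExponent c (hp i) (k i) hJ (hkill i)
  choose e he hcard using hblock
  have hfix : ∀ j, {x // T^[j] x = x} ≃
      ∀ i, {x : F[X] ⧸ Ideal.span {p i ^ k i} // (X ^ j - 1 : F[X]) • x = 0} := fun j =>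
    (Equiv.subtypeEquiv ((Module.AEval'.of T).toEquiv.trans E.toEquiv) fun x => by
      rw [← hsmul, ← E.map_eq_zero_iff, map_smul, funext_iff]
      rfl).trans Equiv.subtypePiEquivPi
  refine ⟨ι, inferInstance, fun i => (p i).natDegree * k i, e, ?_, he, fun j hj => ?_⟩
  · have h1 : Nat.card V = ∏ i, Nat.card (F[X] ⧸ Ideal.span {p i ^ k i}) := by
      rw [← Nat.card_pi]
      exact Nat.card_congr ((Module.AEval'.of T).toEquiv.trans E.toEquiv)
    simp_rw [card_quotient_span (pow_ne_zero _ (hp _).ne_zero), natDegree_pow] at h1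
    rw [Module.natCard_eq_pow_finrank (K := F), Nat.card_eq_fintype_card,
      Finset.prod_pow_eq_pow_sum] at h1
    rw [Nat.pow_right_injective Fintype.one_lt_card h1]
    exact Finset.sum_congr rfl fun i _ => mul_comm _ _
  · rw [Nat.card_congr (hfix j), Nat.card_pi, Finset.prod_congr rfl fun i _ => hcard i j hj,
      Finset.prod_pow_eq_pow_sum]

/-! ### Labeled partitions -/

/-- A partition of `n` with a divisor of `q ^ i - 1` attached to each of its parts `i`. -/
abbrev LabeledPartition (q n : ℕ) : Type :=
  (lam : n.Partition) × ∀ i : Finset.Icc 1 n, Sym (q ^ (i : ℕ) - 1).divisors (lam.parts.count ↑i)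

theorem LabeledPartition.card (q n : ℕ) :
    Nat.card (LabeledPartition q n) = ∑ lam : n.Partition, ∏ i ∈ Finset.Icc 1 n,
      (numDivisors q i + lam.parts.count i - 1).choose (lam.parts.count i) := by
  rw [Nat.card_sigma]
  refine Finset.sum_congr rfl fun lam _ => ?_
  rw [Nat.card_pi, ← Finset.prod_coe_sort (Finset.Icc 1 n)]
  refine Finset.prod_congr rfl fun i _ => ?_
  rw [Nat.card_eq_fintype_card, Sym.card_sym_eq_choose, Fintype.card_coe, numDivisors]

/-- The sum of `w i e` over the parts `i` with labels `e` of a labeled partition. -/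
def LabeledPartition.weight {q n : ℕ} (s : LabeledPartition q n) (w : ℕ → ℕ → ℕ) : ℕ :=
  ∑ i : Finset.Icc 1 n, ((s.2 i).1.map fun e => w i e.1).sum

/-- A family of dimensions with orders dividing `q ^ d - 1` amounts to a labeled partition. -/
theorem LabeledPartition.exists_weight_eq {q n : ℕ} (hq : 1 < q) {ι : Type*} [Fintype ι]
    (d e : ι → ℕ) (hd : ∑ i, d i = n) (he : ∀ i, e i ∣ q ^ d i - 1) :
    ∃ s : LabeledPartition q n, ∀ w : ℕ → ℕ → ℕ, (∀ e, w 0 e = 0) →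
      s.weight w = ∑ i, w (d i) (e i) := by
  classical
  -- `ofSums` discards the zero dimensions, hence the condition `w 0 e = 0`.
  let lam : n.Partition := Nat.Partition.ofSums n (Finset.univ.val.map d) hd
  have hlam : ∀ i : Finset.Icc 1 n, Fintype.card {k // d k = i} = lam.parts.count ↑i := by
    rintro ⟨i, hi⟩
    have hi0 : i ≠ 0 := Nat.one_le_iff_ne_zero.1 (Finset.mem_Icc.1 hi).1
    change _ = (Multiset.filter (· ≠ 0) (Finset.univ.val.map d)).count i
    rw [Multiset.count_filter_of_pos (p := (· ≠ 0)) hi0, Multiset.count_map,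
      Fintype.card_subtype]
    simp only [eq_comm]
    rfl
  have hmem : ∀ (i : Finset.Icc 1 n) (k : {k // d k = i}), e k ∈ (q ^ (i : ℕ) - 1).divisors := by
    intro i k
    have := Nat.one_lt_pow (Nat.one_le_iff_ne_zero.1 (Finset.mem_Icc.1 i.2).1) hq
    refine Nat.mem_divisors.2 ⟨?_, by omega⟩
    simpa only [k.2] using he k
  refine ⟨⟨lam, fun i => ⟨Finset.univ.val.map fun k : {k // d k = i} => ⟨e k, hmem i k⟩, ?_⟩⟩,
    fun w hw => ?_⟩
  · rw [Multiset.card_map, ← hlam]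
    rfl
  · have hmaps : ∀ k ∈ Finset.univ.filter (fun k => d k ≠ 0), d k ∈ Finset.Icc 1 n := by
      intro k hk
      exact Finset.mem_Icc.2 ⟨Nat.one_le_iff_ne_zero.2 (Finset.mem_filter.1 hk).2,
        hd ▸ Finset.single_le_sum (fun _ _ => Nat.zero_le _) (Finset.mem_univ k)⟩
    have hzero : ∑ k, w (d k) (e k) = ∑ k with d k ≠ 0, w (d k) (e k) := by
      rw [Finset.sum_filter]
      refine Finset.sum_congr rfl fun k _ => ?_
      split_ifs with h
      · rfl
      · rw [not_not.1 h, hw]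
    rw [hzero, ← Finset.sum_fiberwise_of_maps_to hmaps, ← Finset.sum_coe_sort, weight]
    refine Finset.sum_congr rfl fun i _ => ?_
    have hi0 : (i : ℕ) ≠ 0 := Nat.one_le_iff_ne_zero.1 (Finset.mem_Icc.1 i.2).1
    rw [Multiset.map_map]
    change ∑ k : {k // d k = i}, w i (e k) = _
    rw [Finset.filter_filter, Finset.sum_subtype (p := fun k => d k = i)]
    · refine Finset.sum_congr rfl fun k _ => ?_
      rw [k.2]
    · intro k
      simp only [Finset.mem_filter_univ]
      exact ⟨fun h => h.2, fun h => ⟨h ▸ hi0, h⟩⟩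

theorem lemma3p1 (q : ℕ) (F : Type*) [Field F] [Fintype F] (hq : Fintype.card F = q) (n : ℕ) :
    numBijLinearGraphs F n ≤
      ∑ lam : n.Partition, ∏ i ∈ Finset.Icc 1 n,
        (numDivisors q i + lam.parts.count i - 1).choose (lam.parts.count i) := by
  subst hq
  obtain ⟨c, hchar⟩ := CharP.exists F
  have : Fact c.Prime := ⟨CharP.char_is_prime F c⟩
  have hex : ∀ C : bijLinearGraphClasses F n, ∃ s : LabeledPartition (Fintype.card F) n,
      ∃ T : (Fin n → F) →ₗ[F] (Fin n → F), Function.Bijective T ∧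
        (C : Quotient (digraphIsoSetoid (Fin n → F))) = ⟦functionalGraph T⟧ ∧
        ∀ j, 0 < j → Nat.card {x // T^[j] x = x} =
          Fintype.card F ^ s.weight (Polynomial.fixedExponent (Fintype.card F) c j) := by
    rintro ⟨C, T, hT, rfl⟩
    obtain ⟨ι, _, d, e, hd, he, hcard⟩ := T.exists_card_iterate_eq_pow_sum_fixedExponent c hT
    rw [Module.finrank_fin_fun] at hd
    obtain ⟨s, hs⟩ := LabeledPartition.exists_weight_eq Fintype.one_lt_card d e hd he
    refine ⟨s, T, hT, rfl, fun j hj => ?_⟩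
    rw [hcard j hj, hs _ (Polynomial.fixedExponent_zero _ c j)]
  choose s T hT hC hcard using hex
  -- The labels depend on choices of `T` and of a decomposition, but they recover the fixed-point
  -- counts, hence the class.
  have hinj : Function.Injective s := by
    intro C D hCD
    rw [← Subtype.coe_inj, hC, hC]
    refine Quotient.sound
      (digraphIso_functionalGraph_of_card_fixed_eq (hT C) (hT D) fun j hj => ?_)
    rw [hcard C j hj, hcard D j hj, hCD]
  rw [← LabeledPartition.card, numBijLinearGraphs, ← Nat.card_coe_set_eq]
  exact Nat.card_le_card_of_injective s hinj
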